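/- All rings are associative with identity. A finite ring is a *chain ring* if its left ideals form a chain under inclusion and its right ideals form a chain under inclusion. **Notions.** Let $R$ be a finite ring with unit group $R^\times$. For $f:R\to\mathbb C$ put $\mathrm{Sym}_\ell(f)=\{u\in R^\times: f(ux)=f(x)\ \forall x\in R\}$ and $\mathrm{Sym}_r(f)=\{u\in R^\times: f(xu)=f(x)\ \forall x\in R\}$. An *invariant weight* on $R$ is a function $w:R\to\mathbb C$ with $w(0)=0$ and $\mathrm{Sym}_\ell(w)=R^\times=\mathrm{Sym}_r(w)$; it is extended to $R^n$ by $w(x)=w(x_1)+\dots+w(x_n)$. *MacWilliams' Equivalence (Extension) Theorem holds for $w$* if for every integer $n\ge 1$, every left submodule $C\le {}_RR^n$ and every $R$-linear map $\phi:C\to {}_RR^n$ with $w(\phi(x))=w(x)$ for all $x\in C$, there are a permutation $\pi$ of $\{1,\dots,n\}$ and units $u_1,\dots,u_n\in \mathrm{Sym}_r(w)$ such that the bijective $R$-linear map $(x_1,\dots,x_n)\mapsto(x_{\pi(1)}u_1,\dots,x_{\pi(n)}u_n)$ of $R^n$ extends $\phi$. Let $\mu$ be the (complex-valued) Möbius function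 of the set of principal left ideals of $R$ ordered by inclusion. For $x\in R$ let $x^\perp=\{r\in R: rs=0\ \forall s\in Rx\}$, and for $t\in R$ write $x^\perp\le t$ if $x^\perp\subseteq Rt$. For $E\subseteq R$ consider the condition $$(\ast)\qquad \sum_{t\in E,\; x^\perp\le t}\mu(0,Rxt)\,w(tx)\neq 0\quad\text{for all } x\in E\setminus\{0\}.$$ **Theorem.** 1. Let $R=R_1\times\dots\times R_r$ be a direct product of finite chain rings, let $p_i$ generate the Jacobson radical of $R_i$ (as a left ideal), let $d_i$ be the nilpotency index of $p_i$, and let $E=\{(p_1^{e_1},\dots,p_r^{e_r}) : 0\le e_i\le d_i\}$, a set of representatives of the generators of the principal left ideals of $R$. If $w$ is an invariant weight on $R$ satisfying $(\ast)$, then MacWilliams' Equivalence Theorem holds for $w$. 2. A finite commutative ring is a principal ideal ring if and only if it is isomorphic to a finite direct product of finite chain rings. In particular the above applies to finite commutative principal ideal rings: if $R$ is such a ring, $E\subseteq R$ contains exactly one generator of each principal ideal of $R$, and $w$ is an invariant weight on $R$ satisfying $(\ast)$, then MacWilliams' Equivalence Theorem holds for $w$. -/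

import Mathlib

universe u

namespace RingCode

/-- A chain ring: its left ideals form a chain under inclusion, and so do its right ideals. -/
structure IsChainRing (R : Type u) [Ring R] : Prop where
  left_total : ∀ I J : Ideal R, I ≤ J ∨ J ≤ I
  right_total : ∀ I J : Submodule (MulOpposite R) R, I ≤ J ∨ J ≤ I

/-- The partially ordered set (under inclusion) of the principal left ideals `Rx` of `R`. -/
abbrev PrincipalLeftIdeal (R : Type u) [Ring R] : Type u :=
  {I : Ideal R // ∃ x : R, I = Ideal.span {x}}

/-- The principal left ideal `Rx`. -/
def principal {R : Type u} [Ring R] (x : R) : PrincipalLeftIdeal R :=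
  ⟨Ideal.span {x}, x, rfl⟩

/-- The complex-valued Möbius function of the poset of principal left ideals of a finite ring. -/
noncomputable def mobius {R : Type u} [Ring R] [Finite R] (I J : PrincipalLeftIdeal R) : ℂ :=
  letI : Fintype (PrincipalLeftIdeal R) := Fintype.ofFinite _
  letI : DecidableEq (PrincipalLeftIdeal R) := Classical.decEq _
  letI : DecidableLE (PrincipalLeftIdeal R) := Classical.decRel _
  letI : DecidableLT (PrincipalLeftIdeal R) := Classical.decRel _
  letI : LocallyFiniteOrder (PrincipalLeftIdeal R) := Fintype.toLocallyFiniteOrder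
  IncidenceAlgebra.mu ℂ I J

/-- The left symmetry group of `f`: the units `u` with `f (u x) = f x` for all `x`. -/
def symLeft {R : Type u} [Ring R] (f : R → ℂ) : Subgroup Rˣ where
  carrier := {u | ∀ x : R, f (u * x) = f x}
  one_mem' := by intro x; simp
  mul_mem' := by
    intro a b ha hb x
    rw [Units.val_mul, mul_assoc, ha, hb]
  inv_mem' := by
    intro a ha x
    rw [← ha, Units.mul_inv_cancel_left]

/-- The right symmetry group of `f`: the units `u` with `f (x u) = f x` for all `x`. -/
def symRight {R : Type u} [Ring R] (f : R → ℂ) : Subgroup Rˣ where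
  carrier := {u | ∀ x : R, f (x * u) = f x}
  one_mem' := by intro x; simp
  mul_mem' := by
    intro a b ha hb x
    rw [Units.val_mul, ← mul_assoc, hb, ha]
  inv_mem' := by
    intro a ha x
    rw [← ha, Units.inv_mul_cancel_right]

/-- An invariant weight: `w 0 = 0` and both symmetry groups are the whole unit group. -/
structure IsInvariantWeight {R : Type u} [Ring R] (w : R → ℂ) : Prop where
  map_zero : w 0 = 0
  symLeft_eq_top : symLeft w = ⊤
  symRight_eq_top : symRight w = ⊤

/-- The extension of a weight to `Rⁿ`: `w(x) = w(x₁) + ⋯ + w(xₙ)`. -/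
def vecWeight {R : Type u} (w : R → ℂ) {n : ℕ} (x : Fin n → R) : ℂ :=
  ∑ i, w (x i)

/-- A linear automorphism of the left module `Rⁿ` is `G`-monomial if it has the form
`x ↦ (x_{π(1)} u₁, …, x_{π(n)} uₙ)` with a permutation `π` and units `uᵢ ∈ G`. -/
def IsMonomial {R : Type u} [Ring R] (G : Subgroup Rˣ) {n : ℕ}
    (T : (Fin n → R) ≃ₗ[R] (Fin n → R)) : Prop :=
  ∃ (π : Equiv.Perm (Fin n)) (v : Fin n → Rˣ),
    (∀ i, v i ∈ G) ∧ ∀ x : Fin n → R, T x = fun i => x (π i) * (v i : R)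

/-- MacWilliams' Equivalence (Extension) Theorem holds for `w` on `R`: every linear `w`-isometry
from a linear code `C ≤ Rⁿ` (a left submodule) into `Rⁿ` extends to a `Sym_r(w)`-monomial
transformation of `Rⁿ`. -/
def MacWilliamsEquivalence {R : Type u} [Ring R] (w : R → ℂ) : Prop :=
  ∀ n : ℕ, 0 < n → ∀ (C : Submodule R (Fin n → R)) (φ : C →ₗ[R] (Fin n → R)),
    (∀ x : C, vecWeight w (φ x) = vecWeight w (x : Fin n → R)) →
      ∃ T : (Fin n → R) ≃ₗ[R] (Fin n → R),
        IsMonomial (symRight w) T ∧ ∀ x : C, T (x : Fin n → R) = φ x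

/-- The orthogonal ideal `x^⊥ = {r | r s = 0 for all s ∈ Rx}`. -/
def perp {R : Type u} [Ring R] (x : R) : Ideal R :=
  Submodule.annihilator (Ideal.span {x} : Ideal R)

/-- The sum `∑ μ(0, Rxt) w(tx)` over those `t ∈ E` with `x^⊥ ≤ t`, i.e. `x^⊥ ⊆ Rt`. -/
noncomputable def diagonalSum {R : Type u} [Ring R] [Finite R] (E : Set R) (w : R → ℂ)
    (x : R) : ℂ :=
  ∑ t ∈ (Set.toFinite {t : R | t ∈ E ∧ perp x ≤ Ideal.span {t}}).toFinset,
    mobius (principal 0) (principal (x * t)) * w (t * x)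

/-- For `R = R₁ × ⋯ × R_r` and generators `pᵢ` of the radicals, the set `E` of all
`(p₁ ^ e₁, …, p_r ^ e_r)` with `0 ≤ eᵢ ≤ dᵢ`, where `dᵢ` is the nilpotency index of `pᵢ`. -/
def chainRepresentatives {r : ℕ} {S : Fin r → Type u} [∀ i, Ring (S i)] (p : ∀ i, S i) :
    Set (∀ i, S i) :=
  {x | ∃ e : Fin r → ℕ, (∀ i, e i ≤ nilpotencyClass (p i)) ∧ x = fun i => p i ^ e i}

/-- `E` contains exactly one generator of each principal left ideal of `R`. -/
def IsRepresentativeSystem {R : Type u} [Ring R] (E : Set R) : Prop :=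
  ∀ x : R, ∃! e : R, e ∈ E ∧ Ideal.span {e} = (Ideal.span {x} : Ideal R)

end RingCode

/-! Fix a codeword `m` with image `φ m`. By linearity the two vectors have equal weight after
scaling by every `t`, hence equal sums of the Möbius transform `mobiusTransform E w a` for every
`a`. This transform is invariant under left units, vanishes at `x` unless `a ∈ Rx`
(`IsDualDuo.mobiusTransform_eq_zero`), and at `x = a` is the diagonal sum of `(∗)`. The system is
thus triangular for inclusion, and the numbers of coordinates generating each given left ideal agree
for `m` and `φ m` (`IsDualDuo.sum_eq_of_sum_weight_eq`).

Consequently every left-unit-invariant function has equal coordinate sums, in particular `x ↦ ∑ u, χ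
(x * u)` for an additive character `χ` trivial on no nonzero left ideal. Linear independence of
characters on the code then matches the coordinate functionals of the two embeddings up to
permutation and right units (`exists_perm_of_sum_eq`).

Only the properties collected in `IsDualDuo` are needed. They hold for finite chain rings and pass
to products and across isomorphisms; the commutative case follows by localizing at the maximal
ideals. -/

namespace RingCode

/-! ### The abstract class of rings and its closure properties. -/

section DualDuo

/-- Finite-ring properties shared by direct products of finite chain rings: a principal left ideal
ring in which left and right multiples agree, zero products commute, generators of principal left
ideals are unique up to units, and some additive character is trivial on no nonzero left ideal. -/
structure IsDualDuo (R : Type u) [Ring R] : Prop where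
  isPrincipalIdealRing : IsPrincipalIdealRing R
  exists_mul_left : ∀ x r : R, ∃ s, x * r = s * x
  exists_mul_right : ∀ x r : R, ∃ s, r * x = x * s
  mul_eq_zero_symm : ∀ a b : R, a * b = 0 → b * a = 0
  exists_unit_of_span_eq : ∀ x y : R, Ideal.span {x} = Ideal.span {y} → ∃ u : Rˣ, y = u * x
  exists_unit_right : ∀ (x : R) (v : Rˣ), ∃ u : Rˣ, v * x = x * u
  exists_addChar : ∃ χ : AddChar R ℂ, ∀ x : R, (∀ r, χ (r * x) = 1) → x = 0

theorem IsDualDuo.of_ringEquiv {R S : Type u} [Ring R] [Ring S] (f : R ≃+* S)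
    (h : IsDualDuo S) : IsDualDuo R where
  isPrincipalIdealRing :=
    haveI := h.isPrincipalIdealRing
    IsPrincipalIdealRing.of_surjective f.symm f.symm.surjective
  exists_mul_left x r := by
    obtain ⟨s, hs⟩ := h.exists_mul_left (f x) (f r)
    exact ⟨f.symm s, f.injective (by simpa using hs)⟩
  exists_mul_right x r := by
    obtain ⟨s, hs⟩ := h.exists_mul_right (f x) (f r)
    exact ⟨f.symm s, f.injective (by simpa using hs)⟩
  mul_eq_zero_symm a b hab := f.injective (by
    simpa using h.mul_eq_zero_symm (f a) (f b) (by rw [← map_mul, hab, map_zero]))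
  exists_unit_of_span_eq x y hxy := by
    have key : (Ideal.span {f x} : Ideal S) = Ideal.span {f y} := by
      have := congrArg (Ideal.map f) hxy
      simpa [Ideal.map_span] using this
    obtain ⟨u, hu⟩ := h.exists_unit_of_span_eq _ _ key
    exact ⟨Units.mapEquiv f.symm.toMulEquiv u, f.injective (by simpa using hu)⟩
  exists_unit_right x v := by
    obtain ⟨u, hu⟩ := h.exists_unit_right (f x) (Units.mapEquiv f.toMulEquiv v)
    exact ⟨Units.mapEquiv f.symm.toMulEquiv u, f.injective (by simpa using hu)⟩
  exists_addChar := by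
    obtain ⟨χ, hχ⟩ := h.exists_addChar
    refine ⟨χ.compAddMonoidHom (f : R →+ S), fun x hx => f.injective ?_⟩
    rw [map_zero]
    refine hχ _ fun r => ?_
    simpa using hx (f.symm r)

theorem IsDualDuo.pi {ι : Type} [Finite ι] {S : ι → Type u} [∀ i, Ring (S i)]
    (h : ∀ i, IsDualDuo (S i)) : IsDualDuo (∀ i, S i) where
  isPrincipalIdealRing :=
    haveI := fun i => (h i).isPrincipalIdealRing
    inferInstance
  exists_mul_left x r := by
    choose s hs using fun i => (h i).exists_mul_left (x i) (r i)
    exact ⟨s, funext hs⟩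
  exists_mul_right x r := by
    choose s hs using fun i => (h i).exists_mul_right (x i) (r i)
    exact ⟨s, funext hs⟩
  mul_eq_zero_symm a b hab :=
    funext fun i => (h i).mul_eq_zero_symm (a i) (b i) (congrFun hab i)
  exists_unit_of_span_eq x y hxy := by
    have key (i : ι) : (Ideal.span {x i} : Ideal (S i)) = Ideal.span {y i} := by
      simpa [Ideal.map_span] using congrArg (Ideal.map (Pi.evalRingHom S i)) hxy
    choose u hu using fun i => (h i).exists_unit_of_span_eq _ _ (key i)
    exact ⟨MulEquiv.piUnits.symm u, funext hu⟩
  exists_unit_right x v := by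
    choose u hu using fun i => (h i).exists_unit_right (x i) (MulEquiv.piUnits v i)
    exact ⟨MulEquiv.piUnits.symm u, funext hu⟩
  exists_addChar := by
    classical
    have := Fintype.ofFinite ι
    choose χ hχ using fun i => (h i).exists_addChar
    refine ⟨∏ i, (χ i).compAddMonoidHom (Pi.evalAddMonoidHom S i), fun x hx => funext fun i => ?_⟩
    refine hχ i _ fun r => ?_
    have := hx (Pi.single i r)
    rw [AddChar.prod_apply, Finset.prod_eq_single i] at this
    · simpa using this
    · intro j _ hj
      simp [Pi.single_eq_of_ne hj]
    · simp

end DualDuo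

/-! ### Structure of finite chain rings. -/

section ChainRing

theorem eq_of_eq_image_of_comparable {α : Type u} [Finite α] {s t : Set α} (f : α → α)
    (hf : Function.Injective f) (hs : s = f '' t) (hle : s ⊆ t ∨ t ⊆ s) : s = t := by
  have hcard : s.ncard = t.ncard := by rw [hs, Set.ncard_image_of_injective _ hf]
  rcases hle with h | h
  · exact Set.eq_of_subset_of_ncard_le h hcard.ge (Set.toFinite _)
  · exact (Set.eq_of_subset_of_ncard_le h hcard.le (Set.toFinite _)).symm

theorem span_singleton_unit_mul {R : Type u} [Ring R] (u : Rˣ) (x : R) :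
    (Ideal.span {(u : R) * x} : Ideal R) = Ideal.span {x} := by
  refine le_antisymm ?_ ?_ <;> rw [Ideal.span_singleton_le_iff_mem, Ideal.mem_span_singleton']
  · exact ⟨u, rfl⟩
  · exact ⟨(u⁻¹ : Rˣ), by simp⟩

variable {R : Type u} [Ring R] [Finite R]

theorem IsChainRing.isPrincipalIdealRing (h : IsChainRing R) : IsPrincipalIdealRing R := by
  refine ⟨fun I => ?_⟩
  obtain ⟨x, hx, hmax⟩ := Set.Finite.exists_maximalFor
    (fun x => (Ideal.span {x} : Ideal R)) (I : Set R) (Set.toFinite _) ⟨0, I.zero_mem⟩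
  refine ⟨x, le_antisymm (fun y hy => ?_) ((Ideal.span_singleton_le_iff_mem I).2 hx)⟩
  rcases h.left_total (Ideal.span {y}) (Ideal.span {x}) with h' | h'
  · exact h' (Ideal.mem_span_singleton_self y)
  · exact hmax hy h' (Ideal.mem_span_singleton_self y)

/-- The larger of `Ra` and `R(1 - a)` contains `a + (1 - a) = 1`. This locality lets fixed-point
equations `a * x = x` produce units. -/
theorem IsChainRing.isUnit_or_isUnit_one_sub (h : IsChainRing R) (a : R) :
    IsUnit a ∨ IsUnit (1 - a) := by
  have key (x : R) (hx : a ∈ Ideal.span {x}) (hx' : 1 - a ∈ Ideal.span {x}) : IsUnit x := by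
    have h1 : (1 : R) ∈ Ideal.span {x} := by simpa using add_mem hx hx'
    obtain ⟨b, hb⟩ := Ideal.mem_span_singleton'.1 h1
    exact isUnit_of_mul_isUnit_right (hb ▸ isUnit_one)
  rcases h.left_total (Ideal.span {a}) (Ideal.span {1 - a}) with h' | h'
  · exact Or.inr (key _ (h' (Ideal.mem_span_singleton_self _)) (Ideal.mem_span_singleton_self _))
  · exact Or.inl (key _ (Ideal.mem_span_singleton_self _) (h' (Ideal.mem_span_singleton_self _)))

theorem IsChainRing.isUnit_of_mul_eq_self (h : IsChainRing R) {a x : R} (hx : x ≠ 0)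
    (hax : a * x = x) : IsUnit a := by
  refine (h.isUnit_or_isUnit_one_sub a).resolve_right fun hu => hx ?_
  exact hu.mul_right_eq_zero.1 (by rw [sub_mul, one_mul, hax, sub_self])

theorem IsChainRing.isUnit_of_mul_eq_self_right (h : IsChainRing R) {a x : R} (hx : x ≠ 0)
    (hax : x * a = x) : IsUnit a := by
  refine (h.isUnit_or_isUnit_one_sub a).resolve_right fun hu => hx ?_
  exact hu.mul_left_eq_zero.1 (by rw [mul_sub, mul_one, hax, sub_self])

/-- For a unit `u`, the left ideals `Rxu` and `Rx` are comparable and equinumerous, hence equal. A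
non-unit `r` is reached through the unit `1 - r`. -/
theorem IsChainRing.exists_mul_left (h : IsChainRing R) (x r : R) : ∃ s, x * r = s * x := by
  have key (u : R) (hu : IsUnit u) : ∃ s, x * u = s * x := by
    have e : ((Ideal.span {x * u} : Ideal R) : Set R) = (Ideal.span {x} : Ideal R) := by
      refine eq_of_eq_image_of_comparable (· * u) hu.mul_left_injective ?_
        (h.left_total _ _)
      ext y
      simp only [SetLike.mem_coe, Ideal.mem_span_singleton', Set.mem_image]
      constructor
      · rintro ⟨a, rfl⟩
        exact ⟨a * x, ⟨a, rfl⟩, mul_assoc _ _ _⟩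
      · rintro ⟨_, ⟨a, rfl⟩, rfl⟩
        exact ⟨a, (mul_assoc _ _ _).symm⟩
    have hm : x * u ∈ (Ideal.span {x} : Ideal R) := by
      rw [← SetLike.mem_coe, ← e]; exact Ideal.mem_span_singleton_self _
    obtain ⟨s, hs⟩ := Ideal.mem_span_singleton'.1 hm
    exact ⟨s, hs.symm⟩
  rcases h.isUnit_or_isUnit_one_sub r with hr | hr
  · exact key r hr
  · obtain ⟨s, hs⟩ := key _ hr
    exact ⟨1 - s, by rw [sub_mul, ← hs]; noncomm_ring⟩

theorem IsChainRing.exists_mul_right (h : IsChainRing R) (x r : R) : ∃ s, r * x = x * s := by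
  have hm (x y : R) : y ∈ Submodule.span (MulOpposite R) {x} ↔ ∃ a, x * a = y := by
    rw [Submodule.mem_span_singleton]
    exact ⟨fun ⟨a, ha⟩ => ⟨a.unop, ha⟩, fun ⟨a, ha⟩ => ⟨MulOpposite.op a, ha⟩⟩
  have key (u : R) (hu : IsUnit u) : ∃ s, u * x = x * s := by
    have e : (Submodule.span (MulOpposite R) {u * x} : Set R) =
        Submodule.span (MulOpposite R) {x} := by
      refine eq_of_eq_image_of_comparable (u * ·) hu.mul_right_injective ?_
        (h.right_total _ _)
      ext y
      simp only [SetLike.mem_coe, hm, Set.mem_image]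
      constructor
      · rintro ⟨a, rfl⟩
        exact ⟨x * a, ⟨a, rfl⟩, (mul_assoc _ _ _).symm⟩
      · rintro ⟨_, ⟨a, rfl⟩, rfl⟩
        exact ⟨a, mul_assoc _ _ _⟩
    have hm' : u * x ∈ Submodule.span (MulOpposite R) {x} := by
      rw [← SetLike.mem_coe, ← e]; exact Submodule.mem_span_singleton_self _
    obtain ⟨s, hs⟩ := (hm _ _).1 hm'
    exact ⟨s, hs.symm⟩
  rcases h.isUnit_or_isUnit_one_sub r with hr | hr
  · exact key r hr
  · obtain ⟨s, hs⟩ := key _ hr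
    exact ⟨1 - s, by rw [mul_sub, ← hs]; noncomm_ring⟩

theorem IsChainRing.exists_unit_of_span_eq (h : IsChainRing R) (x y : R)
    (hxy : (Ideal.span {x} : Ideal R) = Ideal.span {y}) : ∃ u : Rˣ, y = u * x := by
  obtain ⟨a, ha⟩ := Ideal.mem_span_singleton'.1 (hxy.symm ▸ Ideal.mem_span_singleton_self y)
  obtain ⟨b, hb⟩ := Ideal.mem_span_singleton'.1 (hxy ▸ Ideal.mem_span_singleton_self x)
  rcases eq_or_ne x 0 with rfl | hx
  · exact ⟨1, by simpa using ha.symm⟩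
  · have hu : IsUnit (b * a) := h.isUnit_of_mul_eq_self hx (by rw [mul_assoc, ha, hb])
    obtain ⟨u, rfl⟩ := isUnit_of_mul_isUnit_right hu
    exact ⟨u, ha.symm⟩

theorem IsChainRing.exists_unit_right (h : IsChainRing R) (x : R) (v : Rˣ) :
    ∃ u : Rˣ, v * x = x * u := by
  obtain ⟨s, hs⟩ := h.exists_mul_right x v
  obtain ⟨t, ht⟩ := h.exists_mul_right x (v⁻¹ : Rˣ)
  rcases eq_or_ne x 0 with rfl | hx
  · exact ⟨1, by simp⟩
  · have hu : IsUnit (t * s) := h.isUnit_of_mul_eq_self_right hx (by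
      rw [← mul_assoc, ← ht, mul_assoc, ← hs, Units.inv_mul_cancel_left])
    obtain ⟨u, rfl⟩ := isUnit_of_mul_isUnit_right hu
    exact ⟨u, hs⟩

theorem IsChainRing.mem_jacobson_iff [Nontrivial R] (h : IsChainRing R) (x : R) :
    x ∈ Ring.jacobson R ↔ ¬ IsUnit x := by
  constructor
  · intro hx hu
    obtain ⟨M, hM⟩ := Ideal.exists_maximal R
    have hxM : x ∈ M := (Submodule.mem_sInf.1 hx) M hM.out
    exact hM.ne_top (Ideal.eq_top_of_isUnit_mem M hxM hu)
  · refine fun hx => Submodule.mem_sInf.2 fun M hM => ?_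
    by_contra hxM
    have hlt : M < Ideal.span {x} :=
      lt_of_le_not_ge ((h.left_total M (Ideal.span {x})).resolve_right
        fun h' => hxM (h' (Ideal.mem_span_singleton_self x)))
        fun h' => hxM (h' (Ideal.mem_span_singleton_self x))
    have h1 : (1 : R) ∈ Ideal.span {x} := by
      rw [show Ideal.span {x} = ⊤ from hM.2 _ hlt]; trivial
    obtain ⟨b, hb⟩ := Ideal.mem_span_singleton'.1 h1
    exact hx (isUnit_of_mul_isUnit_right (hb ▸ isUnit_one))

theorem IsChainRing.isNilpotent_of_not_isUnit (h : IsChainRing R) {x : R} (hx : ¬ IsUnit x) :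
    IsNilpotent x := by
  obtain ⟨m, n, hmn, e⟩ := Finite.exists_ne_map_eq_of_infinite (fun k : ℕ => x ^ k)
  wlog hlt : m < n generalizing m n
  · exact this n m hmn.symm e.symm (by omega)
  refine ⟨m, ?_⟩
  by_contra h0
  obtain ⟨k, rfl⟩ := Nat.exists_eq_add_of_lt hlt
  have hu : IsUnit (x ^ (k + 1)) := h.isUnit_of_mul_eq_self_right h0 (by
    rw [← pow_add, ← add_assoc]; exact e.symm)
  exact hx ((isUnit_pow_iff k.succ_ne_zero).1 hu)

theorem IsChainRing.isNilpotent_of_span_eq_jacobson (h : IsChainRing R) {p : R}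
    (hp : Ideal.span {p} = Ring.jacobson R) : IsNilpotent p := by
  nontriviality R
  refine h.isNilpotent_of_not_isUnit ((h.mem_jacobson_iff p).1 ?_)
  exact hp ▸ Ideal.mem_span_singleton_self p

theorem IsChainRing.exists_eq_unit_mul_pow (h : IsChainRing R) {p : R}
    (hp : Ideal.span {p} = Ring.jacobson R) (x : R) : ∃ (u : Rˣ) (k : ℕ), x = u * p ^ k := by
  nontriviality R
  have key (n : ℕ) : (∃ (u : Rˣ) (k : ℕ), x = u * p ^ k) ∨ ∃ r, x = r * p ^ n := by
    induction n with
    | zero => exact Or.inr ⟨x, by simp⟩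
    | succ n ih =>
      refine ih.elim Or.inl ?_
      rintro ⟨r, hr⟩
      by_cases hu : IsUnit r
      · obtain ⟨u, rfl⟩ := hu
        exact Or.inl ⟨u, n, hr⟩
      · rw [← h.mem_jacobson_iff, ← hp] at hu
        obtain ⟨s, rfl⟩ := Ideal.mem_span_singleton'.1 hu
        exact Or.inr ⟨s, by rw [hr, pow_succ', mul_assoc]⟩
  obtain ⟨n, hn⟩ := h.isNilpotent_of_span_eq_jacobson hp
  refine (key n).elim id ?_
  rintro ⟨r, hr⟩
  exact ⟨1, n, by rw [hr, hn, mul_zero, mul_zero]⟩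

/-- Units move across powers of `p`, so both products vanish exactly when `p ^ (i + j)` does. -/
theorem IsChainRing.mul_eq_zero_symm (h : IsChainRing R) (a b : R) (hab : a * b = 0) :
    b * a = 0 := by
  obtain ⟨p, hp⟩ := (h.isPrincipalIdealRing).principal (Ring.jacobson R)
  obtain ⟨u, i, rfl⟩ := h.exists_eq_unit_mul_pow hp.symm a
  obtain ⟨v, j, rfl⟩ := h.exists_eq_unit_mul_pow hp.symm b
  have key : p ^ (i + j) = 0 := by
    obtain ⟨t, ht⟩ := h.exists_unit_right (p ^ j) v
    rw [mul_assoc, Units.mul_right_eq_zero, ht, ← mul_assoc, Units.mul_left_eq_zero,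
      ← pow_add] at hab
    exact hab
  obtain ⟨t, ht⟩ := h.exists_unit_right (p ^ i) u
  rw [mul_assoc, ht, ← mul_assoc (p ^ j), ← pow_add, add_comm, key, zero_mul, mul_zero]

theorem IsChainRing.exists_addChar (h : IsChainRing R) :
    ∃ χ : AddChar R ℂ, ∀ x : R, (∀ r, χ (r * x) = 1) → x = 0 := by
  rcases subsingleton_or_nontrivial R with hR | hR
  · exact ⟨1, fun x _ => Subsingleton.elim _ _⟩
  -- In a chain, the minimal nonzero left ideal `Rz` lies in every nonzero one, so nontriviality of
  -- `χ` at `z` suffices.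
  obtain ⟨z, hz, hmin⟩ := Set.Finite.exists_minimalFor (fun x => (Ideal.span {x} : Ideal R))
    {x : R | x ≠ 0} (Set.toFinite _) ⟨1, one_ne_zero⟩
  obtain ⟨χ, hχ⟩ := AddChar.exists_apply_ne_zero.2 hz
  refine ⟨χ, fun x hx => ?_⟩
  by_contra hx0
  have hzx : (Ideal.span {z} : Ideal R) ≤ Ideal.span {x} :=
    (h.left_total _ _).elim id fun h' => hmin hx0 h'
  obtain ⟨r, rfl⟩ := Ideal.mem_span_singleton'.1 (hzx (Ideal.mem_span_singleton_self z))
  exact hχ (hx r)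

theorem IsChainRing.isDualDuo (h : IsChainRing R) : IsDualDuo R where
  isPrincipalIdealRing := h.isPrincipalIdealRing
  exists_mul_left := h.exists_mul_left
  exists_mul_right := h.exists_mul_right
  mul_eq_zero_symm := h.mul_eq_zero_symm
  exists_unit_of_span_eq := h.exists_unit_of_span_eq
  exists_unit_right := h.exists_unit_right
  exists_addChar := h.exists_addChar

theorem IsChainRing.eq_of_span_pow_eq (h : IsChainRing R) {p : R}
    (hp : Ideal.span {p} = Ring.jacobson R) {i j : ℕ} (hi : i ≤ nilpotencyClass p)
    (hj : j ≤ nilpotencyClass p) (e : (Ideal.span {p ^ i} : Ideal R) = Ideal.span {p ^ j}) :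
    i = j := by
  wlog hij : i < j generalizing i j
  · rcases lt_trichotomy i j with h' | h' | h'
    · exact absurd h' hij
    · exact h'
    · exact (this hj hi e.symm h').symm
  -- In the zero ring the nilpotency index is 0, which leaves no room for `i < j`.
  have hR : Nontrivial R := by
    by_contra hR
    rw [not_nontrivial_iff_subsingleton] at hR
    rw [nilpotencyClass_eq_zero_of_subsingleton] at hj
    omega
  exfalso
  obtain ⟨k, rfl⟩ := Nat.exists_eq_add_of_lt hij
  obtain ⟨a, ha⟩ := Ideal.mem_span_singleton'.1 (e ▸ Ideal.mem_span_singleton_self (p ^ i))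
  have hne : p ^ i ≠ 0 := fun h0 => by
    have : nilpotencyClass p ≤ i := Nat.sInf_le h0
    omega
  have hu : IsUnit (a * p ^ (k + 1)) := h.isUnit_of_mul_eq_self hne (by
    rw [mul_assoc, ← pow_add, show k + 1 + i = i + k + 1 by omega, ha])
  have hup : IsUnit p := (isUnit_pow_iff k.succ_ne_zero).1 (isUnit_of_mul_isUnit_right hu)
  exact (h.mem_jacobson_iff p).1 (hp ▸ Ideal.mem_span_singleton_self p) hup

theorem isRepresentativeSystem_chainRepresentatives {r : ℕ} {S : Fin r → Type u}
    [∀ i, Ring (S i)] [∀ i, Finite (S i)] (h : ∀ i, IsChainRing (S i)) {p : ∀ i, S i}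
    (hp : ∀ i, Ideal.span {p i} = Ring.jacobson (S i)) :
    IsRepresentativeSystem (chainRepresentatives p) := by
  intro x
  choose u k hx using fun i => (h i).exists_eq_unit_mul_pow (hp i) (x i)
  have hpow (i : Fin r) : p i ^ min (k i) (nilpotencyClass (p i)) = p i ^ k i := by
    rcases le_total (k i) (nilpotencyClass (p i)) with h' | h'
    · rw [min_eq_left h']
    · have h0 := pow_nilpotencyClass ((h i).isNilpotent_of_span_eq_jacobson (hp i))
      rw [min_eq_right h', h0, pow_eq_zero_of_le h' h0]
  -- Exponents beyond the nilpotency index all give zero, so truncating them is harmless and makes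
  -- the representative unique.
  refine ⟨fun i => p i ^ min (k i) (nilpotencyClass (p i)),
    ⟨⟨_, fun i => min_le_right _ _, rfl⟩, ?_⟩, ?_⟩
  · rw [← span_singleton_unit_mul (MulEquiv.piUnits.symm u)]
    congr 2
    funext i
    simp only [Pi.mul_apply, hpow]
    exact (hx i).symm
  · rintro _ ⟨⟨e, he, rfl⟩, hspan⟩
    funext i
    have hi : (Ideal.span {p i ^ e i} : Ideal (S i)) = Ideal.span {x i} := by
      simpa [Ideal.map_span] using congrArg (Ideal.map (Pi.evalRingHom S i)) hspan
    rw [hx i, span_singleton_unit_mul, ← hpow i] at hi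
    rw [(h i).eq_of_span_pow_eq (hp i) (he i) (min_le_right _ _) hi]

end ChainRing

/-! ### Commutative principal ideal rings as products of chain rings. -/

section Commutative

theorem isChainRing_of_isLocalRing (R : Type u) [CommRing R] [IsLocalRing R]
    [IsPrincipalIdealRing R] : IsChainRing R := by
  have key (I J : Ideal R) : I ≤ J ∨ J ≤ I := by
    obtain ⟨a, rfl⟩ := IsPrincipalIdealRing.principal I
    obtain ⟨b, rfl⟩ := IsPrincipalIdealRing.principal J
    change Ideal.span {a} ≤ Ideal.span {b} ∨ Ideal.span {b} ≤ Ideal.span {a}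
    obtain ⟨d, hd⟩ := IsPrincipalIdealRing.principal (Ideal.span {a, b} : Ideal R)
    change Ideal.span {a, b} = Ideal.span {d} at hd
    have had : a ∈ Ideal.span {d} := hd ▸ Ideal.subset_span (by simp)
    have hbd : b ∈ Ideal.span {d} := hd ▸ Ideal.subset_span (by simp)
    have hdab : d ∈ Ideal.span {a, b} := hd ▸ Ideal.mem_span_singleton_self d
    obtain ⟨a', rfl⟩ := Ideal.mem_span_singleton'.1 had
    obtain ⟨b', rfl⟩ := Ideal.mem_span_singleton'.1 hbd
    obtain ⟨r, s, hrs⟩ := Ideal.mem_span_pair.1 hdab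
    simp only [Ideal.span_singleton_le_span_singleton]
    -- With `d = r a' d + s b' d`: if `r a'` is a unit then so is `a'`, and `a' d` generates `(d)`;
    -- otherwise `1 - r a'` is a unit and `d` is a multiple of `b' d`.
    rcases IsLocalRing.isUnit_or_isUnit_one_sub_self (r * a') with hu | hu
    · obtain ⟨v, rfl⟩ := isUnit_of_mul_isUnit_right hu
      exact Or.inr ⟨b' * (v⁻¹ : Rˣ), by linear_combination (-b' * d) * v.inv_mul⟩
    · have h1 : (1 - r * a') * d = s * b' * d := by linear_combination -hrs
      obtain ⟨v, hv⟩ := hu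
      exact Or.inl ⟨a' * (v⁻¹ : Rˣ) * s, by
        rw [← hv] at h1
        linear_combination (-a' * d) * v.inv_mul + a' * (v⁻¹ : Rˣ) * h1⟩
  refine ⟨key, fun I J => ?_⟩
  let toIdeal (K : Submodule (MulOpposite R) R) : Ideal R :=
    { K.toAddSubmonoid with
      smul_mem' := fun c x hx => by
        have := K.smul_mem (MulOpposite.op c) hx
        rwa [MulOpposite.smul_eq_mul_unop, MulOpposite.unop_op, mul_comm] at this }
  exact key (toIdeal I) (toIdeal J)

/-- A finite commutative ring is Artinian, hence the product of its localizations at maximal ideals.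
These are quotients of it, so they inherit finiteness and principality. -/
theorem isPrincipalIdealRing_iff_exists_chainRings (R : Type u) [CommRing R] [Finite R] :
    IsPrincipalIdealRing R ↔
      ∃ (r : ℕ) (S : Fin r → Type u) (_ : ∀ i, Ring (S i)),
        (∀ i, Finite (S i) ∧ IsChainRing (S i)) ∧ Nonempty (R ≃+* (∀ i, S i)) := by
  constructor
  · intro hR
    obtain ⟨r, ⟨e⟩⟩ := Finite.exists_equiv_fin (MaximalSpectrum R)
    refine ⟨r, fun i => Localization.AtPrime (e.symm i).asIdeal, inferInstance, fun i => ?_,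
      ⟨(MaximalSpectrum.toPiLocalizationEquiv R).toRingEquiv.trans
        (RingEquiv.piCongrLeft (fun I : MaximalSpectrum R => Localization.AtPrime I.asIdeal)
          e.symm).symm⟩⟩
    have hs := IsArtinianRing.localization_surjective (e.symm i).asIdeal.primeCompl
      (Localization.AtPrime (e.symm i).asIdeal)
    have := IsPrincipalIdealRing.of_surjective _ hs
    exact ⟨Finite.of_surjective _ hs, isChainRing_of_isLocalRing _⟩
  · rintro ⟨r, S, _, hS, ⟨f⟩⟩
    have (i : Fin r) := (hS i).1
    have (i : Fin r) := (hS i).2.isPrincipalIdealRing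
    exact IsPrincipalIdealRing.of_surjective f.symm f.symm.surjective

end Commutative

end RingCode

namespace RingCode

/-! ### Counting lemmas. -/

section Counting

/-- Well-founded induction turns vanishing sums over lower sets into vanishing sums over fibres of
`k`, where `g ∘ k` is constant. -/
theorem sum_mul_eq_zero_of_sum_filter_le_eq_zero {ι P : Type*} [PartialOrder P] [Finite P]
    [DecidableLE P] (s : Finset ι) (k : ι → P) (f : ι → ℂ)
    (H : ∀ K, ∑ i ∈ s with k i ≤ K, f i = 0) (g : P → ℂ) : ∑ i ∈ s, f i * g (k i) = 0 := by
  classical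
  have := Fintype.ofFinite P
  have fib (K : P) : ∑ i ∈ s with k i = K, f i = 0 := by
    induction K using WellFoundedLT.induction with
    | ind K ih =>
      have hlt : ∑ i ∈ s with k i < K, f i = 0 := by
        rw [← Finset.sum_fiberwise _ k]
        refine Finset.sum_eq_zero fun K' _ => ?_
        rw [Finset.filter_filter]
        by_cases hK : K' < K
        · rw [← ih K' hK]
          congr 1
          ext i
          simp only [Finset.mem_filter, and_congr_right_iff, and_iff_right_iff_imp]
          rintro - rfl
          exact hK
        · refine Finset.sum_eq_zero fun i hi => ?_
          obtain ⟨-, h1, rfl⟩ := Finset.mem_filter.1 hi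
          exact absurd h1 hK
      have := H K
      simp only [le_iff_eq_or_lt] at this
      rwa [Finset.filter_or, Finset.sum_union, hlt, add_zero] at this
      rw [Finset.disjoint_filter]
      rintro i - h1 h2
      exact h2.ne h1
  rw [← Finset.sum_fiberwise _ k]
  refine Finset.sum_eq_zero fun K _ => ?_
  rw [Finset.sum_congr rfl (g := fun i => f i * g K), ← Finset.sum_mul, fib, zero_mul]
  intro i hi
  rw [(Finset.mem_filter.1 hi).2]

theorem card_fiber_eq_of_sum_eq {ι κ V : Type*} [Fintype ι] [DecidableEq κ] [AddCommGroup V]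
    [Module ℂ V] {v : κ → V} (hv : LinearIndependent ℂ v) (A B : ι → κ)
    (h : ∑ j, v (A j) = ∑ j, v (B j)) (g : κ) :
    (Finset.univ.filter fun j => A j = g).card = (Finset.univ.filter fun j => B j = g).card := by
  have key : ∑ j, Finsupp.single (A j) (1 : ℂ) = ∑ j, Finsupp.single (B j) (1 : ℂ) := by
    apply hv
    simpa [map_sum] using h
  have := DFunLike.congr_fun key g
  simp only [Finsupp.finsetSum_apply, Finsupp.single_apply, Finset.sum_boole] at this
  exact_mod_cast this

theorem exists_perm_of_card_fiber_eq {ι Q : Type*} [Fintype ι] [DecidableEq Q] (f g : ι → Q)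
    (h : ∀ q, (Finset.univ.filter fun i => f i = q).card =
      (Finset.univ.filter fun i => g i = q).card) :
    ∃ π : Equiv.Perm ι, ∀ i, f (π i) = g i := by
  have e (q : Q) : Nonempty ({i // g i = q} ≃ {i // f i = q}) := by
    rw [← Fintype.card_eq, Fintype.card_subtype, Fintype.card_subtype, h]
  exact ⟨Equiv.ofFiberEquiv fun q => (e q).some, Equiv.ofFiberEquiv_map _⟩

end Counting

/-! ### Annihilators and divisibility. -/

section Duality

variable {R : Type u} [Ring R]

theorem IsDualDuo.mem_perp (h : IsDualDuo R) {x r : R} : r ∈ perp x ↔ r * x = 0 := by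
  rw [perp, Submodule.mem_annihilator]
  constructor
  · exact fun H => H x (Ideal.mem_span_singleton_self x)
  · intro H y hy
    obtain ⟨a, rfl⟩ := Ideal.mem_span_singleton'.1 hy
    obtain ⟨s, hs⟩ := h.exists_mul_right x a
    rw [smul_eq_mul, hs, ← mul_assoc, H, zero_mul]

variable [Finite R]

omit [Finite R] in
theorem IsDualDuo.card_perp_mul_card_span (h : IsDualDuo R) (x : R) :
    Nat.card (perp x) * Nat.card (Ideal.span {x} : Ideal R) = Nat.card R := by
  have hker : LinearMap.ker (LinearMap.toSpanSingleton R R x) = perp x := by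
    ext r
    simp [h.mem_perp]
  have e := (LinearMap.toSpanSingleton R R x).quotKerEquivRange
  rw [LinearMap.range_toSpanSingleton, hker] at e
  have h2 := Nat.card_congr e.toEquiv
  rw [mul_comm, (perp x).card_eq_card_quotient_mul_card, mul_comm (Nat.card _), h2]

/-- Double annihilator property: if `x^⊥ = Ry`, then `Rx ⊆ y^⊥`, and `|x^⊥| |Rx| = |R|` applied to
`x` and `y` forces equality. -/
theorem IsDualDuo.mem_span_of_perp_le (h : IsDualDuo R) {x a : R} (hle : perp x ≤ perp a) :
    a ∈ Ideal.span {x} := by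
  obtain ⟨y, hy⟩ := h.isPrincipalIdealRing.principal (perp x)
  change perp x = Ideal.span {y} at hy
  have hyx : y ∈ perp x := hy ▸ Ideal.mem_span_singleton_self y
  have hx : x ∈ perp y := h.mem_perp.2 (h.mul_eq_zero_symm _ _ (h.mem_perp.1 hyx))
  have ha : a ∈ perp y := h.mem_perp.2 (h.mul_eq_zero_symm _ _ (h.mem_perp.1 (hle hyx)))
  have hcard : Nat.card (perp y) = Nat.card (Ideal.span {x} : Ideal R) := by
    have h1 := h.card_perp_mul_card_span x
    rw [← h.card_perp_mul_card_span y, hy, mul_comm] at h1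
    exact (Nat.eq_of_mul_eq_mul_right Nat.card_pos h1).symm
  have hsub : ((Ideal.span {x} : Ideal R) : Set R) ⊆ perp y :=
    (Ideal.span_singleton_le_iff_mem _).2 hx
  rw [← SetLike.mem_coe, Set.eq_of_subset_of_ncard_le hsub hcard.le (Set.toFinite _)]
  exact ha

omit [Finite R] in
theorem IsDualDuo.mul_eq_zero_of_mem_perp (h : IsDualDuo R) {a n : R} (hn : n ∈ perp a) :
    a * n = 0 :=
  h.mul_eq_zero_symm _ _ (h.mem_perp.1 hn)

omit [Finite R] in
theorem IsDualDuo.mul_mem_span (h : IsDualDuo R) (a : R) {s t : R} (hts : t ∈ Ideal.span {s}) :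
    a * t ∈ Ideal.span {a * s} := by
  obtain ⟨r, rfl⟩ := Ideal.mem_span_singleton'.1 hts
  obtain ⟨r', hr'⟩ := h.exists_mul_left a r
  exact Ideal.mem_span_singleton'.2 ⟨r', by rw [← mul_assoc, ← hr', mul_assoc]⟩

-- Left multiplication by `a` reflects divisibility above `a^⊥`: from `a t = a r' s`, the difference
-- `t - r' s` lies in `a^⊥ ⊆ Rs`.
omit [Finite R] in
theorem IsDualDuo.mem_span_of_mul_mem (h : IsDualDuo R) {a s t : R} (hs : perp a ≤ Ideal.span {s})
    (hts : a * t ∈ Ideal.span {a * s}) : t ∈ Ideal.span {s} := by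
  obtain ⟨r, hr⟩ := Ideal.mem_span_singleton'.1 hts
  obtain ⟨r', hr'⟩ := h.exists_mul_right a r
  have h0 : t - r' * s ∈ perp a := h.mem_perp.2 (h.mul_eq_zero_symm _ _ (by
    rw [mul_sub, ← mul_assoc, ← hr', mul_assoc, hr, sub_self]))
  have := add_mem (hs h0) (Ideal.mul_mem_left _ r' (Ideal.mem_span_singleton_self s))
  rwa [sub_add_cancel] at this

end Duality

/-! ### Möbius inversion of the weight. -/

section Moebius

variable {R : Type u} [Ring R] [Finite R]

theorem sum_mobius_eq_zero {J : PrincipalLeftIdeal R} (hJ : principal 0 ≠ J) :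
    ∑ I ∈ (Set.toFinite {I | I ≤ J}).toFinset, mobius (principal 0) I = 0 := by
  let _ : Fintype (PrincipalLeftIdeal R) := Fintype.ofFinite _
  let _ : DecidableEq (PrincipalLeftIdeal R) := Classical.decEq _
  let _ : DecidableLE (PrincipalLeftIdeal R) := Classical.decRel _
  let _ : DecidableLT (PrincipalLeftIdeal R) := Classical.decRel _
  let _ : LocallyFiniteOrder (PrincipalLeftIdeal R) := Fintype.toLocallyFiniteOrder
  have key := IncidenceAlgebra.sum_Icc_mu_right (𝕜 := ℂ) (principal (0 : R)) J
  rw [if_neg hJ] at key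
  rw [← key]
  refine Finset.sum_congr ?_ fun _ _ => rfl
  ext I
  have h0 : principal 0 ≤ I := by
    change (Ideal.span {0} : Ideal R) ≤ I.1
    simp
  simp [h0]

/-- The map `t ↦ Rat` identifies the index set with the principal left ideals below `Ras`, where the
defining Möbius recursion applies. -/
theorem IsDualDuo.sum_mobius_mul_eq_zero (h : IsDualDuo R) {E : Set R}
    (hE : IsRepresentativeSystem E) {a s : R} (hs : perp a ≤ Ideal.span {s}) (has : a * s ≠ 0) :
    ∑ t ∈ (Set.toFinite {t : R | (t ∈ E ∧ perp a ≤ Ideal.span {t}) ∧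
      t ∈ Ideal.span {s}}).toFinset, mobius (principal 0) (principal (a * t)) = 0 := by
  have hne : principal 0 ≠ principal (a * s) := by
    intro e
    have : (Ideal.span {0} : Ideal R) = Ideal.span {a * s} := congrArg Subtype.val e
    exact has (Ideal.span_singleton_eq_bot.1
      (this.symm.trans (Ideal.span_singleton_eq_bot.2 rfl)))
  rw [← sum_mobius_eq_zero hne]
  refine Finset.sum_bij (fun t _ => principal (a * t)) ?_ ?_ ?_ (fun _ _ => rfl)
  · intro t ht
    rw [Set.Finite.mem_toFinset] at ht ⊢
    exact (Ideal.span_singleton_le_iff_mem _).2 (h.mul_mem_span a ht.2)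
  · intro t ht t' ht' e
    rw [Set.Finite.mem_toFinset] at ht ht'
    have e' : (Ideal.span {a * t} : Ideal R) = Ideal.span {a * t'} := congrArg Subtype.val e
    refine (hE t').unique ⟨ht.1.1, le_antisymm ?_ ?_⟩ ⟨ht'.1.1, rfl⟩ <;>
      rw [Ideal.span_singleton_le_iff_mem]
    · exact h.mem_span_of_mul_mem ht'.1.2 (e' ▸ Ideal.mem_span_singleton_self _)
    · exact h.mem_span_of_mul_mem ht.1.2 (e' ▸ Ideal.mem_span_singleton_self _)
  · rintro ⟨_, b, rfl⟩ hI
    rw [Set.Finite.mem_toFinset] at hI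
    have hb : b ∈ Ideal.span {a * s} := (Ideal.span_singleton_le_iff_mem _).1 hI
    obtain ⟨r, rfl⟩ := Ideal.mem_span_singleton'.1 hb
    obtain ⟨r', hr'⟩ := h.exists_mul_right a r
    have hb' : r * (a * s) = a * (r' * s) := by rw [← mul_assoc, hr', mul_assoc]
    -- Adding `a^⊥` puts the preimage in the index set and does not change its product with `a`.
    obtain ⟨t₀, ht₀⟩ := h.isPrincipalIdealRing.principal (Ideal.span {r' * s} ⊔ perp a)
    change _ = Ideal.span {t₀} at ht₀
    obtain ⟨t, ⟨htE, ht⟩, -⟩ := hE t₀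
    rw [← ht₀] at ht
    refine ⟨t, ?_, Subtype.ext ?_⟩
    · rw [Set.Finite.mem_toFinset]
      refine ⟨⟨htE, ht.symm ▸ le_sup_right⟩, ?_⟩
      rw [← Ideal.span_singleton_le_iff_mem, ht]
      refine sup_le ((Ideal.span_singleton_le_iff_mem _).2 ?_) hs
      exact Ideal.mul_mem_left _ _ (Ideal.mem_span_singleton_self s)
    · change Ideal.span {a * t} = Ideal.span {r * (a * s)}
      rw [hb']
      refine le_antisymm ?_ ?_ <;> rw [Ideal.span_singleton_le_iff_mem]
      · have htm : t ∈ Ideal.span {r' * s} ⊔ perp a := ht ▸ Ideal.mem_span_singleton_self t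
        obtain ⟨y, hy, z, hz, rfl⟩ := Submodule.mem_sup.1 htm
        rw [mul_add, h.mul_eq_zero_of_mem_perp hz, add_zero]
        exact h.mul_mem_span a hy
      · exact h.mul_mem_span a (ht ▸ Ideal.mem_sup_left (Ideal.mem_span_singleton_self _))

omit [Finite R] in
theorem IsDualDuo.exists_factor (h : IsDualDuo R) {F : R → ℂ}
    (hF : ∀ (u : Rˣ) (x : R), F (u * x) = F x) :
    ∃ G : Ideal R → ℂ, ∀ x, F x = G (Ideal.span {x}) := by
  obtain ⟨G, hG⟩ := (Function.factorsThrough_iff (f := fun x : R => (Ideal.span {x} : Ideal R))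
    F).1 fun x y hxy => by
      obtain ⟨u, rfl⟩ := h.exists_unit_of_span_eq x y hxy
      exact (hF u x).symm
  exact ⟨G, congrFun hG⟩

omit [Finite R] in
theorem IsInvariantWeight.map_unit_mul {w : R → ℂ} (hw : IsInvariantWeight w) (u : Rˣ) (x : R) :
    w (u * x) = w x :=
  (show u ∈ symLeft w from hw.symLeft_eq_top ▸ Subgroup.mem_top u) x

omit [Finite R] in
theorem IsInvariantWeight.map_mul_unit {w : R → ℂ} (hw : IsInvariantWeight w) (u : Rˣ) (x : R) :
    w (x * u) = w x :=
  (show u ∈ symRight w from hw.symRight_eq_top ▸ Subgroup.mem_top u) x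

/-- The Möbius transform of `w` at `a`, as a function of `x`; its value at `x = a` is the
diagonal sum. -/
noncomputable def mobiusTransform (E : Set R) (w : R → ℂ) (a x : R) : ℂ :=
  ∑ t ∈ (Set.toFinite {t : R | t ∈ E ∧ perp a ≤ Ideal.span {t}}).toFinset,
    mobius (principal 0) (principal (a * t)) * w (t * x)

/-- Since `w (t * x)` depends only on `Rtx`, it is enough to sum the Möbius coefficients over `{t |
tx ∈ K} = Rs` for each `K`. -/
theorem IsDualDuo.mobiusTransform_eq_zero (h : IsDualDuo R) {E : Set R}
    (hE : IsRepresentativeSystem E) {w : R → ℂ} (hw : IsInvariantWeight w) {a x : R}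
    (hax : a ∉ Ideal.span {x}) : mobiusTransform E w a x = 0 := by
  classical
  obtain ⟨W, hW⟩ := h.exists_factor hw.map_unit_mul
  simp only [mobiusTransform, hW]
  refine sum_mul_eq_zero_of_sum_filter_le_eq_zero _ (fun t => (Ideal.span {t * x} : Ideal R)) _
    (fun K => ?_) W
  obtain ⟨s, hs⟩ := h.isPrincipalIdealRing.principal
    (Submodule.comap (LinearMap.toSpanSingleton R R x) K)
  change _ = Ideal.span {s} at hs
  have hmem (t : R) : t ∈ Ideal.span {s} ↔ t * x ∈ K := by
    rw [← hs]; simp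
  by_cases hle : perp a ≤ Ideal.span {s}
  · rw [← h.sum_mobius_mul_eq_zero hE hle]
    · refine Finset.sum_congr ?_ fun _ _ => rfl
      ext t
      simp [hmem]
    -- If `a s = 0`, then `x^⊥ ⊆ Rs ⊆ a^⊥`, and the double annihilator property would give `a ∈ Rx`.
    · refine fun has => hax (h.mem_span_of_perp_le fun r hr => ?_)
      have hrs : r ∈ Ideal.span {s} := (hmem r).2 (by rw [h.mem_perp.1 hr]; exact K.zero_mem)
      obtain ⟨c, rfl⟩ := Ideal.mem_span_singleton'.1 hrs
      rw [h.mem_perp, mul_assoc, h.mul_eq_zero_symm _ _ has, mul_zero]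
  · refine Finset.sum_eq_zero fun t ht => absurd ?_ hle
    rw [Finset.mem_filter, Set.Finite.mem_toFinset, Ideal.span_singleton_le_iff_mem,
      ← hmem] at ht
    exact ht.1.2.trans ((Ideal.span_singleton_le_iff_mem _).2 ht.2)

theorem IsDualDuo.mobiusTransform_unit_mul (h : IsDualDuo R) (E : Set R) {w : R → ℂ}
    (hw : IsInvariantWeight w) (a : R) (v : Rˣ) (x : R) :
    mobiusTransform E w a (v * x) = mobiusTransform E w a x := by
  obtain ⟨u, hu⟩ := h.exists_unit_right x v
  simp only [mobiusTransform, hu, ← mul_assoc, hw.map_mul_unit]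

/-- Two vectors with the same weights after all scalings have the same sums for every function
that is invariant under left multiplication by units. -/
theorem IsDualDuo.sum_eq_of_sum_weight_eq (h : IsDualDuo R) {E : Set R}
    (hE : IsRepresentativeSystem E) {w : R → ℂ} (hw : IsInvariantWeight w)
    (hd : ∀ x ∈ E, x ≠ 0 → diagonalSum E w x ≠ 0) {n : ℕ} {α β : Fin n → R}
    (hαβ : ∀ t, ∑ i, w (t * α i) = ∑ i, w (t * β i)) {F : R → ℂ}
    (hF : ∀ (u : Rˣ) (x : R), F (u * x) = F x) : ∑ i, F (α i) = ∑ i, F (β i) := by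
  classical
  have := Fintype.ofFinite (Ideal R)
  let N (γ : Fin n → R) (K : Ideal R) : ℂ :=
    ((Finset.univ.filter fun i => Ideal.span {γ i} = K).card : ℂ)
  have hsum (γ : Fin n → R) (G : Ideal R → ℂ) :
      ∑ i, G (Ideal.span {γ i}) = ∑ K, N γ K * G K := by
    rw [← Finset.sum_fiberwise _ fun i => (Ideal.span {γ i} : Ideal R)]
    refine Finset.sum_congr rfl fun K _ => ?_
    rw [Finset.sum_congr rfl (g := fun _ => G K), Finset.sum_const, nsmul_eq_mul]
    intro i hi
    rw [(Finset.mem_filter.1 hi).2]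
  -- Induction from large ideals down: in the transform equation at a generator `a` of `K`, only
  -- ideals containing `K` contribute, and those strictly larger are already settled.
  have hN (K : Ideal R) (hK : K ≠ ⊥) : N α K - N β K = 0 := by
    induction K using WellFoundedGT.induction with
    | ind K ih =>
      obtain ⟨a₀, ha₀⟩ := h.isPrincipalIdealRing.principal K
      obtain ⟨a, ⟨haE, ha⟩, -⟩ := hE a₀
      have haK : Ideal.span {a} = K := ha.trans ha₀.symm
      have ha0 : a ≠ 0 := by
        rintro rfl
        exact hK (haK ▸ Ideal.span_singleton_eq_bot.2 rfl)
      obtain ⟨G, hG⟩ := h.exists_factor (h.mobiusTransform_unit_mul E hw a)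
      have key : ∑ i, mobiusTransform E w a (α i) = ∑ i, mobiusTransform E w a (β i) := by
        simp only [mobiusTransform]
        rw [Finset.sum_comm]
        conv_rhs => rw [Finset.sum_comm]
        simp only [← Finset.mul_sum, hαβ]
      simp only [hG, hsum] at key
      rw [← sub_eq_zero, ← Finset.sum_sub_distrib, Finset.sum_eq_single K] at key
      · rw [← sub_mul] at key
        refine (mul_eq_zero.1 key).resolve_right ?_
        rw [← haK, ← hG]
        exact hd a haE ha0
      · intro K' _ hK'
        by_cases hlt : K < K'
        · rw [← sub_mul, ih K' hlt (ne_bot_of_gt hlt), zero_mul]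
        · obtain ⟨x, hx⟩ := h.isPrincipalIdealRing.principal K'
          change K' = Ideal.span {x} at hx
          have : G K' = 0 := by
            rw [hx, ← hG]
            refine h.mobiusTransform_eq_zero hE hw fun hax => hlt (lt_of_le_of_ne ?_ hK'.symm)
            rwa [← haK, hx, Ideal.span_singleton_le_iff_mem]
          rw [this, mul_zero, mul_zero, sub_zero]
      · simp
  -- The zero ideal is invisible to the weight; its count follows because all counts total `n`.
  have hN' (K : Ideal R) : N α K = N β K := by
    by_cases hK : K = ⊥
    · subst hK
      have h1 := (hsum α fun _ => 1).symm.trans (hsum β fun _ => 1)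
      rw [← sub_eq_zero, ← Finset.sum_sub_distrib, Finset.sum_eq_single ⊥] at h1
      · simpa [sub_eq_zero] using h1
      · intro K _ hK
        simpa using hN K hK
      · simp
    · exact sub_eq_zero.1 (hN K hK)
  obtain ⟨G, hG⟩ := h.exists_factor hF
  simp only [hG, hsum, hN']

end Moebius

/-! ### From equal character sums to a monomial map. -/

section Extension

variable {R : Type u} [Ring R] [Finite R] {M : Type u} [AddCommGroup M] [Module R M]

-- Distinct functionals give distinct characters: otherwise `χ` would be trivial on the left ideal
-- generated by some `f m - g m ≠ 0`.
omit [Finite R] in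
theorem linearIndependent_addChar_comp [Finite M] {χ : AddChar R ℂ}
    (hχ : ∀ x : R, (∀ r, χ (r * x) = 1) → x = 0) :
    LinearIndependent ℂ fun (g : M →ₗ[R] R) (m : M) => χ (g m) := by
  refine (AddChar.linearIndependent M ℂ).comp
    (fun g : M →ₗ[R] R => χ.compAddMonoidHom g.toAddMonoidHom) fun f g hfg => ?_
  refine LinearMap.ext fun m => sub_eq_zero.1 (hχ _ fun r => ?_)
  have := DFunLike.congr_fun hfg (r • m)
  simp only [AddChar.compAddMonoidHom_apply, LinearMap.toAddMonoidHom_coe, map_smul,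
    smul_eq_mul] at this
  rw [mul_sub, AddChar.map_sub_eq_div, this, div_self (χ.val_isUnit _).ne_zero]

/-- Right multiplication of linear functionals by units, as an equivalence relation. -/
def functionalSetoid (R M : Type u) [Ring R] [AddCommGroup M] [Module R M] :
    Setoid (M →ₗ[R] R) where
  r f g := ∃ u : Rˣ, f.smulRight (u : R) = g
  iseqv :=
    { refl := fun f => ⟨1, by ext; simp⟩
      symm := by
        rintro f _ ⟨u, rfl⟩
        exact ⟨u⁻¹, by ext; simp⟩
      trans := by
        rintro f _ _ ⟨u, rfl⟩ ⟨v, rfl⟩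
        exact ⟨u * v, by ext; simp [mul_assoc]⟩ }

-- For `f i` in the unit orbit of `g`, the units carrying it to `g` form a coset of the stabilizer
-- of `g`; outside the orbit there are none.
omit [Finite R] in
theorem card_smulRight_eq [Fintype Rˣ] [DecidableEq (M →ₗ[R] R)] {ι : Type} [Fintype ι]
    (f : ι → M →ₗ[R] R) (g : M →ₗ[R] R) [DecidablePred fun i => functionalSetoid R M (f i) g] :
    (Finset.univ.filter fun j : ι × Rˣ => (f j.1).smulRight (j.2 : R) = g).card =
      (Finset.univ.filter fun i => functionalSetoid R M (f i) g).card *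
        (Finset.univ.filter fun u : Rˣ => g.smulRight (u : R) = g).card := by
  rw [Finset.card_filter, Fintype.sum_prod_type]
  simp only [← Finset.card_filter]
  rw [Finset.card_filter, Finset.sum_mul]
  refine Finset.sum_congr rfl fun i _ => ?_
  split_ifs with hi
  · obtain ⟨v, rfl⟩ := hi
    rw [one_mul]
    refine Finset.card_bij' (fun u _ => v⁻¹ * u) (fun u _ => v * u) ?_ ?_ ?_ ?_
    · intro u hu
      rw [Finset.mem_filter] at hu ⊢
      refine ⟨Finset.mem_univ _, ?_⟩
      rw [← hu.2]
      ext m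
      have := DFunLike.congr_fun hu.2 m
      simp only [LinearMap.smulRight_apply, smul_eq_mul] at this
      simp [← mul_assoc, mul_assoc (f i m), this]
    · intro u hu
      rw [Finset.mem_filter] at hu ⊢
      refine ⟨Finset.mem_univ _, ?_⟩
      ext m
      have := DFunLike.congr_fun hu.2 m
      simpa [mul_assoc] using this
    · simp
    · simp
  · rw [zero_mul, Finset.card_eq_zero, Finset.filter_eq_empty_iff]
    exact fun u _ hu => hi ⟨u, hu⟩

omit [Finite R] in
theorem exists_perm_of_sum_eq [Finite M] [Fintype Rˣ] {χ : AddChar R ℂ}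
    (hχ : ∀ x : R, (∀ r, χ (r * x) = 1) → x = 0) {n : ℕ} {f g : Fin n → M →ₗ[R] R}
    (hfg : ∀ m, ∑ i, ∑ u : Rˣ, χ (f i m * u) = ∑ i, ∑ u : Rˣ, χ (g i m * u)) :
    ∃ (π : Equiv.Perm (Fin n)) (v : Fin n → Rˣ), ∀ i m, f (π i) m * v i = g i m := by
  classical
  have hcount := card_fiber_eq_of_sum_eq (linearIndependent_addChar_comp (M := M) hχ)
    (fun j : Fin n × Rˣ => (f j.1).smulRight (j.2 : R))
    (fun j : Fin n × Rˣ => (g j.1).smulRight (j.2 : R)) (by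
      funext m
      simpa [Fintype.sum_prod_type, Finset.sum_apply] using hfg m)
  obtain ⟨π, hπ⟩ := exists_perm_of_card_fiber_eq
    (fun i => (Quotient.mk (functionalSetoid R M) (f i)))
    (fun i => (Quotient.mk (functionalSetoid R M) (g i))) (fun q => by
      obtain ⟨k, rfl⟩ := Quotient.exists_rep q
      have := hcount k
      rw [card_smulRight_eq f k, card_smulRight_eq g k] at this
      simp only [Quotient.eq]
      -- The stabilizer contains 1, so its order cancels and leaves equal orbit multiplicities.
      refine Nat.eq_of_mul_eq_mul_right (Finset.card_pos.2 ⟨1, ?_⟩) this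
      rw [Finset.mem_filter]
      exact ⟨Finset.mem_univ _, by ext; simp⟩)
  choose v hv using fun i => Quotient.exact (hπ i)
  exact ⟨π, v, fun i m => DFunLike.congr_fun (hv i) m⟩

/-- The monomial map `x ↦ (x_{π(1)} v₁, …, x_{π(n)} vₙ)`. -/
def monomialEquiv {R : Type u} [Ring R] {n : ℕ} (π : Equiv.Perm (Fin n)) (v : Fin n → Rˣ) :
    (Fin n → R) ≃ₗ[R] (Fin n → R) where
  toFun x i := x (π i) * v i
  invFun y j := y (π.symm j) * ((v (π.symm j))⁻¹ : Rˣ)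
  map_add' x y := by ext i; simp [add_mul]
  map_smul' r x := by ext i; simp [mul_assoc]
  left_inv x := by ext i; simp
  right_inv y := by ext i; simp

theorem IsDualDuo.macWilliamsEquivalence (h : IsDualDuo R) {E : Set R}
    (hE : IsRepresentativeSystem E) {w : R → ℂ} (hw : IsInvariantWeight w)
    (hd : ∀ x ∈ E, x ≠ 0 → diagonalSum E w x ≠ 0) : MacWilliamsEquivalence w := by
  have := Fintype.ofFinite Rˣ
  intro n _ C φ hφ
  obtain ⟨χ, hχ⟩ := h.exists_addChar
  obtain ⟨π, v, hπ⟩ := exists_perm_of_sum_eq hχ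
    (f := fun i => (LinearMap.proj i).comp C.subtype) (g := fun i => (LinearMap.proj i).comp φ)
    (fun m => by
      refine h.sum_eq_of_sum_weight_eq hE hw hd (F := fun x => ∑ u : Rˣ, χ (x * u))
        (fun t => ?_) fun v x => ?_
      -- The isometry condition at the codeword `t • m` supplies the scaled weight equality.
      · simpa [vecWeight] using (hφ (t • m)).symm
      · obtain ⟨u, hu⟩ := h.exists_unit_right x v
        exact Fintype.sum_equiv (Equiv.mulLeft u) _ _ fun u' => by simp [hu, mul_assoc])
  refine ⟨monomialEquiv π v, ⟨π, v, fun i => hw.symRight_eq_top ▸ Subgroup.mem_top _,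
    fun _ => rfl⟩, fun x => ?_⟩
  funext i
  exact hπ i x

end Extension

end RingCode

theorem mainTheorem1 :
    -- finite direct products of finite chain rings
    (∀ (r : ℕ) (S : Fin r → Type u) [∀ i, Ring (S i)] [∀ i, Finite (S i)],
      (∀ i, RingCode.IsChainRing (S i)) →
      ∀ p : ∀ i, S i, (∀ i, Ideal.span {p i} = Ring.jacobson (S i)) →
      ∀ w : (∀ i, S i) → ℂ, RingCode.IsInvariantWeight w →
        (∀ x ∈ RingCode.chainRepresentatives p, x ≠ 0 →
          RingCode.diagonalSum (RingCode.chainRepresentatives p) w x ≠ 0) →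
        RingCode.MacWilliamsEquivalence w) ∧
    -- finite commutative rings: being a product of chain rings means being a principal ideal ring
    (∀ (R : Type u) [CommRing R] [Finite R],
      IsPrincipalIdealRing R ↔
        ∃ (r : ℕ) (S : Fin r → Type u) (_ : ∀ i, Ring (S i)),
          (∀ i, Finite (S i) ∧ RingCode.IsChainRing (S i)) ∧ Nonempty (R ≃+* (∀ i, S i))) ∧
    -- finite commutative principal ideal rings
    (∀ (R : Type u) [CommRing R] [Finite R] [IsPrincipalIdealRing R]
      (E : Set R), RingCode.IsRepresentativeSystem E →
      ∀ w : R → ℂ, RingCode.IsInvariantWeight w →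
        (∀ x ∈ E, x ≠ 0 → RingCode.diagonalSum E w x ≠ 0) →
        RingCode.MacWilliamsEquivalence w) := by
  refine ⟨fun r S _ _ hS p hp w hw hd => ?_, fun R _ _ =>
    RingCode.isPrincipalIdealRing_iff_exists_chainRings R, fun R _ _ hR E hE w hw hd => ?_⟩
  · exact (RingCode.IsDualDuo.pi fun i => (hS i).isDualDuo).macWilliamsEquivalence
      (RingCode.isRepresentativeSystem_chainRepresentatives hS hp) hw hd
  · obtain ⟨r, S, _, hS, ⟨f⟩⟩ :=
      (RingCode.isPrincipalIdealRing_iff_exists_chainRings R).1 hR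
    have (i : Fin r) := (hS i).1
    exact ((RingCode.IsDualDuo.pi fun i => (hS i).2.isDualDuo).of_ringEquiv
      f).macWilliamsEquivalence hE hw hd
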